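/- Let $G$ be an amenable group and let $\mathcal{F}=(F_i)_{i\in I}$ be a (right) Følner net for $G$, i.e. a family of non-empty finite subsets of $G$ indexed by a directed set $I$ such that $\lim_i |F_i\setminus F_i g|/|F_i| = 0$ for every $g\in G$. Let $X$ be an irreducible algebraic variety over an algebraically closed field $K$ (i.e. a scheme of finite type over $K$ whose underlying topological space is irreducible), and let $A := X(K)$ be its set of $K$-points. For a finite subset $\Omega\subset G$, let $X^\Omega$ be the fibered product over $K$ of copies of $X$ indexed by $\Omega$; every subset of $A^\Omega = X^\Omega(K)$, viewed as a set of (closed) points of $X^\Omega$, carries the topology induced by the Zariski topology of $X^\Omega$. For $\Gamma\subset A^G$, let $\Gamma_\Omega\subset A^\Omega$ be the set of restrictions to $\Omega$ of the elements of $\Gamma$, and let $$\operatorname{mdim}_{\mathcal F}(\Gamma) := \limsup_{i\in I}\frac{\dim(\Gamma_{F_i})}{|F_i|},$$ where $\dim$ is the Krull dimension of a topological space (with $\dim\varnothing=-\infty$). Suppose that $\Gamma\subset A^G$ satisfies the following condition: there exist finite subsets $E,E'\subset G$ and a subset $T\subset G$ such that the sets $gE$, $g\in T$, are pairwise disjoint,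 $G=\bigcup_{g\in T} gE'$ (that is, $T$ is an $(E,E')$-tiling), and, for every $g\in T$, $\Gamma_{gE}$ is a closed subset of $A^{gE}$ for the Zariski topology with $\Gamma_{gE}\subsetneq A^{gE}$. Then $$\operatorname{mdim}_{\mathcal F}(\Gamma) < \dim(X).$$ -/

import Mathlib

open CategoryTheory AlgebraicGeometry
open scoped Pointwise

namespace AlgMeanDim

noncomputable section

universe u v w

/-! ### Group theory: Følner nets and tilings -/

section Group

variable {G : Type v} [Group G]

open scoped Classical in
/-- A (right) Følner net for `G`: a family of non-empty finite subsets of `G`, indexed by a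
directed set, such that `|F i \ F i g| / |F i| → 0` for every `g : G`. A group is amenable
if and only if it admits such a net. -/
structure IsFolnerNet {I : Type w} [Preorder I] (F : I → Finset G) : Prop where
  nonempty : ∀ i, (F i).Nonempty
  tendsto : ∀ g : G, Filter.Tendsto
    (fun i => (((F i) \ (F i).image (fun h => h * g)).card : ℝ) / ((F i).card : ℝ))
    Filter.atTop (nhds 0)

open scoped Classical in
/-- The left translate `g E` of a finite subset `E` of `G`. -/
def translate (g : G) (E : Finset G) : Finset G := E.image (fun h => g * h)

/-- `T` is an `(E, E')`-tiling: the sets `g E`, `g ∈ T`, are pairwise disjoint, and the sets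
`g E'`, `g ∈ T`, cover `G`. -/
structure IsTiling (E E' : Finset G) (T : Set G) : Prop where
  disjoint : ∀ g ∈ T, ∀ h ∈ T, g ≠ h → Disjoint (translate g E) (translate h E)
  cover : ∀ x : G, ∃ g ∈ T, x ∈ translate g E'

end Group

/-! ### Points of varieties and the Zariski topology on `X(K) ^ Ω` -/

section Variety

variable {K : Type u} [Field K]

/-- The set `X(K)` of `K`-points of a `K`-scheme `X`: the morphisms of `K`-schemes
`Spec K ⟶ X`. -/
def KPoints (X : Over (Spec (CommRingCat.of K))) : Type u :=
  Over.mk (𝟙 (Spec (CommRingCat.of K))) ⟶ X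

/-- A `K`-scheme is an algebraic variety over `K` if it is of finite type over `K`. -/
structure IsAlgebraicVariety (X : Over (Spec (CommRingCat.of K))) : Prop where
  locallyOfFiniteType : LocallyOfFiniteType X.hom
  quasiCompact : QuasiCompact X.hom

variable {G : Type v}

/-- `X ^ Ω`: the fibered product over `K` of copies of `X` indexed by the finite set `Ω`. -/
def power (X : Over (Spec (CommRingCat.of K))) (Ω : Finset G) :
    Over (Spec (CommRingCat.of K)) :=
  Limits.piObj (fun _ : Ω => X)

/-- The set `A ^ Ω`, where `A = X(K)`. -/
def Pattern (X : Over (Spec (CommRingCat.of K))) (Ω : Finset G) : Type (max u v) :=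
  Ω → KPoints X

/-- The identification of `A ^ Ω = X(K) ^ Ω` with `(X ^ Ω)(K)` given by the universal property
of the fibered product. -/
def Pattern.toKPoint {X : Over (Spec (CommRingCat.of K))} {Ω : Finset G} (p : Pattern X Ω) :
    KPoints (power X Ω) :=
  Limits.Pi.lift (f := fun _ : Ω => X) p

/-- The point of the underlying space of `X` defined by a `K`-point of `X`, that is, the image
of the unique point of `Spec K`. -/
def KPoints.toPoint {X : Over (Spec (CommRingCat.of K))} (x : KPoints X) : X.left :=
  CommaMorphism.left x (IsLocalRing.closedPoint K : PrimeSpectrum K)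

/-- The Zariski topology on `A ^ Ω`: the topology induced from the underlying space of the
scheme `X ^ Ω`. -/
instance (X : Over (Spec (CommRingCat.of K))) (Ω : Finset G) :
    TopologicalSpace (Pattern X Ω) :=
  TopologicalSpace.induced (fun p : Pattern X Ω => p.toKPoint.toPoint)
    (inferInstance : TopologicalSpace (power X Ω).left)

/-- The projection `Γ_Ω ⊆ A ^ Ω` of a set of configurations `Γ ⊆ A ^ G`: the set of
restrictions to `Ω` of the elements of `Γ`. -/
def proj {X : Over (Spec (CommRingCat.of K))} (Γ : Set (G → KPoints X)) (Ω : Finset G) :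
    Set (Pattern X Ω) :=
  (fun (c : G → KPoints X) (g : Ω) => c g) '' Γ

end Variety

/-! ### Algebraic mean dimension -/

/-- Krull dimensions, seen as extended real numbers (the empty space has dimension `-∞`). -/
def dimToEReal : WithBot ℕ∞ → EReal
  | ⊥ => ⊥
  | (n : ℕ∞) => ((n : ENNReal) : EReal)

/-- The Krull dimension of a topological space, as an extended real number. -/
def kdim (Y : Type*) [TopologicalSpace Y] : EReal := dimToEReal (topologicalKrullDim Y)

/-- The algebraic mean dimension of `Γ ⊆ X(K) ^ G` with respect to the net `F`:
the upper limit over the net of `dim (Γ_{F i}) / |F i|`. -/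
def mdim {K : Type u} [Field K] {X : Over (Spec (CommRingCat.of K))} {G : Type v}
    {I : Type w} [Preorder I] (F : I → Finset G) (Γ : Set (G → KPoints X)) : EReal :=
  Filter.limsup (fun i => kdim (proj Γ (F i)) / (((F i).card : ℝ) : EReal)) Filter.atTop

end

end AlgMeanDim

/-! Let `d = dim X`. A proper closed subset of the irreducible space `A ^ gE` has dimension at most
`|gE| * d - 1`, so each tile contained in `F i` costs one dimension. The other coordinates
contribute at most `d` each, hence `dim Γ_{F i} ≤ |F i| * d - #tiles`
(`topologicalKrullDim_proj_le`). The Følner condition gives at least `ε * |F i|` disjoint tiles in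
`F i` for large `i` (`IsFolnerNet.exists_density`), so the quotients are eventually at most `d - ε`.

Dimensions are computed with algebras of functions on `K`-points. `A ^ Ω` is covered by products of
affine charts, whose topology is the Zariski topology of the algebra generated by the coordinates
(`Chart.isZariski`). The dimension of a subset is at most that of the restricted algebra. Noether
normalization makes this bound subadditive over blocks of coordinates (`ringKrullDim_iSup_le_sum`),
and on a tile a nonzero function vanishing on the closed set, in a domain, lowers it by one
(`ringKrullDim_coordAlg_succ_le`). -/

namespace AlgMeanDim

/-! ### Krull dimension and irreducibility of topological spaces -/

section Topology

open TopologicalSpace Topology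

/-- The dimension of a space is bounded by the dimensions of the members of an open cover. -/
theorem topologicalKrullDim_le_of_openCover {Y : Type*} [TopologicalSpace Y] {κ : Type*}
    (U : κ → Set Y) (hU : ∀ k, IsOpen (U k)) (hcov : ∀ y, ∃ k, y ∈ U k) {n : WithBot ℕ∞}
    (h : ∀ k, topologicalKrullDim (U k) ≤ n) : topologicalKrullDim Y ≤ n := by
  refine iSup_le fun l => ?_
  -- A point of the smallest member of the chain lies in all members, so an open set containing it
  -- meets them all and the chain restricts strictly to that set.
  obtain ⟨x, hx⟩ := l.head.2.nonempty
  obtain ⟨k, hk⟩ := hcov x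
  have hmem : ∀ i, x ∈ (l i : Set Y) := fun i => l.head_le i hx
  let emb : IsOpenEmbedding (Subtype.val : U k → Y) := (hU k).isOpenEmbedding_subtypeVal
  let e := IrreducibleCloseds.orderIsoOfIsOpenEmbedding (Subtype.val : U k → Y) emb
  let l' : LTSeries (IrreducibleCloseds (U k)) :=
    { length := l.length
      toFun := fun i => e.symm ⟨l i, ⟨⟨x, hk⟩, hmem i⟩⟩
      step := fun i => e.symm.strictMono (l.step i) }
  exact (Order.LTSeries.length_le_krullDim l').trans (h k)

/-- A topology on a finite power for which the insertions of one coordinate are continuous is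
irreducible if the factors are. -/
theorem preirreducibleSpace_pi {ι A : Type*} [Finite ι] [DecidableEq ι] [TopologicalSpace A]
    [PreirreducibleSpace A] (t : TopologicalSpace (ι → A))
    (h : ∀ (p : ι → A) (i : ι), Continuous (Function.update p i)) : PreirreducibleSpace (ι → A) := by
  have := Fintype.ofFinite ι
  refine ⟨fun U V hU hV => ?_⟩
  rintro ⟨p, -, hp⟩ ⟨q, -, hq⟩
  classical
  induction hn : (Finset.univ.filter fun i => p i ≠ q i).card using Nat.strong_induction_on
    generalizing p q with
  | _ n ih =>
    by_cases hpq : p = q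
    · exact ⟨p, trivial, hp, hpq ▸ hq⟩
    obtain ⟨i, hi⟩ := Function.ne_iff.mp hpq
    -- Moving only coordinate `i` of `p` and of `q` gives two nonempty open subsets of `A`. A common
    -- value `x` makes the two points agree at `i`, so they differ in fewer places.
    obtain ⟨x, -, hxU, hxV⟩ := PreirreducibleSpace.isPreirreducible_univ (X := A) _ _
      (hU.preimage (h p i)) (hV.preimage (h q i))
      ⟨p i, trivial, by simpa using hp⟩ ⟨q i, trivial, by simpa using hq⟩
    refine ih _ ?_ _ hxU _ hxV rfl
    rw [← hn]
    refine Finset.card_lt_card ⟨fun j => ?_, fun hs => ?_⟩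
    · by_cases hj : j = i
      · subst hj; simp
      · simp [hj]
    · have := hs (Finset.mem_filter.mpr ⟨Finset.mem_univ i, hi⟩)
      simp at this

end Topology

/-! ### Dimension of finitely generated algebras and of algebras of functions -/

section Algebra

theorem ringKrullDim_le_of_isIntegral {A B : Type*} [CommRing A] [CommRing B] (f : A →+* B)
    (hf : f.IsIntegral) : ringKrullDim B ≤ ringKrullDim A := by
  algebraize [f]
  have : Algebra.IsIntegral A B := ⟨hf⟩
  refine Order.krullDim_le_of_strictMono (PrimeSpectrum.comap f) fun I J h => ?_
  exact Ideal.IsIntegral.comap_lt_comap (R := A) (I := I.asIdeal) (J := J.asIdeal) h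

/-- Chains of primes lift: lying over lifts the first prime and going up each later one. -/
theorem ringKrullDim_le_of_isIntegral_of_injective {A B : Type*} [CommRing A] [CommRing B]
    (f : A →+* B) (hf : f.IsIntegral) (hinj : Function.Injective f) :
    ringKrullDim A ≤ ringKrullDim B := by
  algebraize [f]
  have : Algebra.IsIntegral A B := ⟨hf⟩
  refine iSup_le fun l => ?_
  obtain ⟨l', h, -⟩ : ∃ l' : LTSeries (PrimeSpectrum B), l'.length = l.length ∧
      PrimeSpectrum.comap f l'.last = l.last := by
    induction l using RelSeries.inductionOn' with
    | singleton x =>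
      obtain ⟨y, hy⟩ := hf.comap_surjective hinj x
      exact ⟨RelSeries.singleton _ y, rfl, hy⟩
    | snoc p x hx hp =>
      obtain ⟨l', h, h'⟩ := hp
      have hlt : PrimeSpectrum.comap f l'.last < x := h' ▸ hx
      obtain ⟨Q, hQ, hQp, hQx⟩ := Ideal.exists_ideal_over_prime_of_isIntegral_of_isPrime
        x.asIdeal l'.last.asIdeal hlt.le
      refine ⟨l'.snoc ⟨Q, hQp⟩ (lt_of_le_of_ne hQ fun he => hlt.ne ?_), by simp [h], ?_⟩
      · exact PrimeSpectrum.ext ((congrArg (Ideal.comap f) he).trans hQx)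
      · rw [RelSeries.last_snoc, RelSeries.last_snoc]; exact PrimeSpectrum.ext hQx
  rw [← h]
  exact Order.LTSeries.length_le_krullDim l'

variable {K : Type*} [Field K]

/-- An algebra generated by the images of finitely many finitely generated algebras has dimension
at most the sum of their dimensions. -/
theorem ringKrullDim_le_sum {B : Type*} [CommRing B] [Algebra K B] {ι : Type*} [Fintype ι]
    {C : ι → Type*} [∀ i, CommRing (C i)] [∀ i, Algebra K (C i)] (f : ∀ i, C i →ₐ[K] B)
    [∀ i, Algebra.FiniteType K (C i)] (hsup : ⨆ i, (f i).range = ⊤) (n : ι → ℕ)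
    (hn : ∀ i, ringKrullDim (C i) ≤ n i) : ringKrullDim B ≤ (∑ i, n i : ℕ) := by
  rcases subsingleton_or_nontrivial B with hB | hB
  · rw [ringKrullDim_eq_bot_of_subsingleton]; exact bot_le
  -- Noether normalization: `C i` is integral over a polynomial ring in at most `n i` variables. All
  -- these variables together give a polynomial ring over which `B` is integral.
  have key : ∀ i, ∃ s, ∃ g : MvPolynomial (Fin s) K →ₐ[K] C i, s ≤ n i ∧ g.IsIntegral := by
    intro i
    have : Nontrivial (C i) := (f i).toRingHom.domain_nontrivial
    obtain ⟨s, g, hinj, hint⟩ := exists_integral_inj_algHom_of_fg K (C i)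
    refine ⟨s, g, ?_, hint⟩
    have := (ringKrullDim_le_of_isIntegral_of_injective _ hint hinj).trans (hn i)
    simpa using this
  choose s g hs hg using key
  let φ : MvPolynomial (Σ i, Fin (s i)) K →ₐ[K] B :=
    MvPolynomial.aeval fun x => f x.1 (g x.1 (MvPolynomial.X x.2))
  have hφ : ∀ i, φ.comp (MvPolynomial.rename (Sigma.mk i)) = (f i).comp (g i) := fun i =>
    MvPolynomial.algHom_ext fun j => by simp [φ]
  have hint : φ.toRingHom.IsIntegral := by
    algebraize [φ.toRingHom]
    let D : Subalgebra K B := (integralClosure (MvPolynomial (Σ i, Fin (s i)) K) B).restrictScalars K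
    have hD : D = ⊤ := by
      rw [eq_top_iff, ← hsup]
      refine iSup_le fun i => ?_
      rintro _ ⟨x, rfl⟩
      have h1 : (φ.toRingHom.comp
          (MvPolynomial.rename (Sigma.mk i) : _ →ₐ[K] _).toRingHom).IsIntegralElem (f i x) := by
        have h2 := (hg i x).map (f i).toRingHom
        have h3 := congrArg (fun f : MvPolynomial (Fin (s i)) K →ₐ[K] B => f.toRingHom) (hφ i)
        change φ.toRingHom.comp (MvPolynomial.rename (Sigma.mk i)).toRingHom =
          (f i).toRingHom.comp (g i).toRingHom at h3
        rw [h3]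
        exact h2
      exact RingHom.isIntegralElem.of_comp _ _ h1
    intro x
    have : x ∈ D := hD ▸ trivial
    exact this
  refine (ringKrullDim_le_of_isIntegral _ hint).trans ?_
  rw [MvPolynomial.ringKrullDim_of_isNoetherianRing]
  simp only [ringKrullDim_eq_zero_of_field, zero_add, Nat.card_eq_fintype_card, Fintype.card_sigma,
    Fintype.card_fin]
  exact_mod_cast Finset.sum_le_sum fun i _ => hs i

theorem ringKrullDim_iSup_le_sum {A : Type*} [CommRing A] [Algebra K A] {ι : Type*} [Fintype ι]
    (S : ι → Subalgebra K A) (hS : ∀ i, (S i).FG) (n : ι → ℕ)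
    (hn : ∀ i, ringKrullDim (S i) ≤ n i) :
    ringKrullDim (⨆ i, S i : Subalgebra K A) ≤ (∑ i, n i : ℕ) := by
  have : ∀ i, Algebra.FiniteType K (S i) := fun i =>
    (Subalgebra.fg_iff_finiteType _).mp (hS i)
  refine ringKrullDim_le_sum (fun i => Subalgebra.inclusion (le_iSup S i)) ?_ n hn
  apply Subalgebra.map_injective (f := (⨆ i, S i).val) Subtype.val_injective
  rw [(Subalgebra.gc_map_comap _).l_iSup, Algebra.map_top, Subalgebra.range_val]
  congr 1
  ext i : 1
  rw [← AlgHom.range_comp]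
  exact (S i).range_val

theorem fg_iSup {A : Type*} [CommRing A] [Algebra K A] {ι : Type*} [Finite ι]
    (S : ι → Subalgebra K A) (hS : ∀ i, (S i).FG) : (⨆ i, S i).FG := by
  have := Fintype.ofFinite ι
  rw [← Finset.sup_univ_eq_iSup]
  exact Finset.sup_induction Subalgebra.fg_bot (fun _ ha _ hb => ha.sup hb) fun i _ => hS i

/-- A topology on `Y` is the Zariski topology of an algebra `O` of functions on `Y` if the
non-vanishing loci of the elements of `O` form a basis of it. -/
structure IsZariski {Y : Type*} [TopologicalSpace Y] (O : Subalgebra K (Y → K)) : Prop where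
  isOpen : ∀ f ∈ O, IsOpen {y | f y ≠ 0}
  exists_mem : ∀ (y : Y) (W : Set Y), IsOpen W → y ∈ W → ∃ f ∈ O, f y ≠ 0 ∧ ∀ z, f z ≠ 0 → z ∈ W

/-- The algebra of functions on `Y` generated by a family of functions. -/
def funAlg {Y σ : Type*} (a : σ → Y → K) : Subalgebra K (Y → K) :=
  Algebra.adjoin K (Set.range a)

/-- Composition with a map, on algebras of functions. -/
def precomp {Y Z : Type*} (g : Z → Y) : (Y → K) →ₐ[K] (Z → K) where
  toFun f := f ∘ g
  map_one' := rfl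
  map_mul' _ _ := rfl
  map_zero' := rfl
  map_add' _ _ := rfl
  commutes' _ := rfl

theorem map_precomp_funAlg {Y Z σ : Type*} (a : σ → Y → K) (g : Z → Y) :
    (funAlg a).map (precomp g) = funAlg fun s => a s ∘ g := by
  rw [funAlg, AlgHom.map_adjoin, ← Set.range_comp]
  rfl

/-- If a function in a domain of functions vanishes on the image of `g`, restriction along `g`
lowers the dimension. -/
theorem ringKrullDim_funAlg_comp_succ_le {Y Z σ : Type*} (a : σ → Y → K) (g : Z → Y)
    [IsDomain (funAlg a)] (f : Y → K) (hf : f ∈ funAlg a) (hf0 : f ≠ 0) (hfg : f ∘ g = 0) :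
    ringKrullDim (funAlg fun s => a s ∘ g) + 1 ≤ ringKrullDim (funAlg a) := by
  rw [← map_precomp_funAlg]
  refine ringKrullDim_succ_le_of_surjective ((precomp g).subalgebraMap (funAlg a)).toRingHom
    ((precomp g).subalgebraMap_surjective _) (r := ⟨f, hf⟩) ?_ ?_
  · exact mem_nonZeroDivisors_of_ne_zero fun h => hf0 (congrArg Subtype.val h)
  · exact Subtype.ext hfg

/-- The point of the spectrum of an algebra of functions given by evaluation at a point. -/
def evalPrime {Y : Type*} (O : Subalgebra K (Y → K)) (y : Y) : PrimeSpectrum O :=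
  ⟨RingHom.ker ((Pi.evalRingHom (fun _ : Y => K) y).comp O.val.toRingHom), RingHom.ker_isPrime _⟩

theorem mem_evalPrime {Y : Type*} (O : Subalgebra K (Y → K)) (y : Y) (f : O) :
    f ∈ (evalPrime O y).asIdeal ↔ (f : Y → K) y = 0 := Iff.rfl

namespace IsZariski

variable {Y : Type*} [TopologicalSpace Y] {O : Subalgebra K (Y → K)}

/-- Evaluation embeds the topology of `Y` in that of the prime spectrum of `O`: `evalPrime` is
inducing, and an inducing map cannot lower the dimension of its target below that of its source. -/
theorem topologicalKrullDim_le (h : IsZariski O) : topologicalKrullDim Y ≤ ringKrullDim O := by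
  rw [← PrimeSpectrum.topologicalKrullDim_eq_ringKrullDim]
  refine Topology.IsInducing.topologicalKrullDim_le (f := evalPrime O) ⟨le_antisymm ?_ ?_⟩
  · refine continuous_iff_le_induced.mp ?_
    rw [PrimeSpectrum.isTopologicalBasis_basic_opens.continuous_iff]
    rintro _ ⟨f, rfl⟩
    exact h.isOpen f f.2
  · intro W hW
    refine (@isOpen_iff_forall_mem_open Y (.induced (evalPrime O) inferInstance) W).mpr
      fun y hy => ?_
    obtain ⟨f, hf, hfy, hfW⟩ := h.exists_mem y W hW hy
    exact ⟨{z | f z ≠ 0}, hfW, ⟨_, (PrimeSpectrum.basicOpen (⟨f, hf⟩ : O)).2, rfl⟩, hfy⟩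

/-- Two nonzero functions have nonempty open non-vanishing loci, which meet by irreducibility. -/
theorem isDomain [PreirreducibleSpace Y] [Nonempty Y] (h : IsZariski O) : IsDomain O := by
  have : NoZeroDivisors O := by
    refine ⟨fun {f g} hfg => ?_⟩
    by_contra! hne
    obtain ⟨y, hy⟩ := Function.ne_iff.mp (fun h => hne.1 (Subtype.ext h) : (f : Y → K) ≠ 0)
    obtain ⟨z, hz⟩ := Function.ne_iff.mp (fun h => hne.2 (Subtype.ext h) : (g : Y → K) ≠ 0)
    obtain ⟨x, -, hx, hx'⟩ := PreirreducibleSpace.isPreirreducible_univ (X := Y) _ _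
      (h.isOpen f f.2) (h.isOpen g g.2) ⟨y, trivial, hy⟩ ⟨z, trivial, hz⟩
    exact mul_ne_zero hx hx' (congrFun (congrArg Subtype.val hfg) x)
  exact NoZeroDivisors.to_isDomain O

theorem comp_inducing {Z σ : Type*} [TopologicalSpace Z] {a : σ → Y → K}
    (h : IsZariski (funAlg a)) {g : Z → Y} (hg : Topology.IsInducing g) :
    IsZariski (funAlg fun s => a s ∘ g) := by
  rw [← map_precomp_funAlg]
  constructor
  · rintro _ ⟨f, hf, rfl⟩
    exact (h.isOpen f hf).preimage hg.continuous
  · intro y W hW hy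
    obtain ⟨V, hV, rfl⟩ := hg.isOpen_iff.mp hW
    obtain ⟨f, hf, h1, h2⟩ := h.exists_mem (g y) V hV hy
    exact ⟨_, ⟨f, hf, rfl⟩, h1, fun z hz => h2 _ hz⟩

end IsZariski

end Algebra

end AlgMeanDim

namespace AlgMeanDim

noncomputable section

universe u v

variable {K : Type u} [Field K] {X : Over (Spec (CommRingCat.of K))} {G : Type v}

/-! ### The Zariski topology on `K`-points and irreducibility of `A ^ Ω` -/

section Points

instance KPoints.topologicalSpace : TopologicalSpace (KPoints X) :=
  TopologicalSpace.induced KPoints.toPoint inferInstance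

/-- A `K`-point followed by a morphism of `K`-schemes. -/
def KPoints.map {Y : Over (Spec (CommRingCat.of K))} (x : KPoints X) (f : X ⟶ Y) : KPoints Y :=
  CategoryStruct.comp (X := Over.mk (𝟙 (Spec (CommRingCat.of K)))) x f

theorem KPoints.map_comp {Y Z : Over (Spec (CommRingCat.of K))} (x : KPoints X) (f : X ⟶ Y)
    (g : Y ⟶ Z) : x.map (f ≫ g) = (x.map f).map g :=
  (Category.assoc (W := Over.mk (𝟙 (Spec (CommRingCat.of K)))) x f g).symm

theorem KPoints.map_id (x : KPoints X) : x.map (𝟙 X) = x :=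
  Category.comp_id (X := Over.mk (𝟙 (Spec (CommRingCat.of K)))) x

theorem KPoints.map_const {Y : Over (Spec (CommRingCat.of K))} (x : KPoints X) (y : KPoints Y) :
    x.map (CategoryStruct.comp (Y := Over.mk (𝟙 (Spec (CommRingCat.of K)))) (Over.homMk X.hom) y) =
      y := by
  refine Over.OverMorphism.ext ?_
  have h : CommaMorphism.left x ≫ X.hom = 𝟙 _ := Over.w x
  change CommaMorphism.left x ≫ X.hom ≫ CommaMorphism.left y = _
  rw [← Category.assoc, h]
  exact Category.id_comp _

theorem KPoints.continuous_map {Y : Over (Spec (CommRingCat.of K))} (f : X ⟶ Y) :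
    Continuous fun x : KPoints X => x.map f :=
  continuous_induced_rng.mpr (f.left.continuous.comp continuous_induced_dom)

theorem Pattern.isInducing_toKPoint (Ω : Finset G) :
    Topology.IsInducing (Pattern.toKPoint : Pattern X Ω → KPoints (power X Ω)) :=
  ⟨by rw [KPoints.topologicalSpace, induced_compose]; rfl⟩

theorem Pattern.map_π {Ω : Finset G} (p : Pattern X Ω) (w : Ω) :
    p.toKPoint.map (Limits.Pi.π (fun _ : Ω => X) w) = p w :=
  Limits.Pi.lift_π (f := fun _ : Ω => X) p w

theorem Pattern.toKPoint_eq {Ω : Finset G} (p : Pattern X Ω) (x : KPoints (power X Ω))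
    (h : ∀ w, x.map (Limits.Pi.π (fun _ : Ω => X) w) = p w) : x = p.toKPoint :=
  Limits.Pi.hom_ext _ _ fun w => (h w).trans (p.map_π w).symm

theorem Pattern.continuous_eval {Ω : Finset G} (w : Ω) :
    Continuous fun p : Pattern X Ω => p w := by
  have := (KPoints.continuous_map (Limits.Pi.π (fun _ : Ω => X) w)).comp
    (Pattern.isInducing_toKPoint (X := X) Ω).continuous
  exact this.congr fun p => p.map_π w

open scoped Classical in
/-- Change one coordinate of a pattern. -/
def Pattern.update {Ω : Finset G} (p : Pattern X Ω) (w : Ω) (x : KPoints X) : Pattern X Ω :=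
  Function.update (β := fun _ : Ω => KPoints X) p w x

open scoped Classical in
-- Inserting a coordinate comes from a morphism `X ⟶ X ^ Ω`: the identity in coordinate `w`, and in
-- the others the constant morphisms `X ⟶ Spec K ⟶ X`.
theorem Pattern.continuous_update {Ω : Finset G} (p : Pattern X Ω) (w : Ω) :
    Continuous (p.update w) := by
  rw [(Pattern.isInducing_toKPoint Ω).continuous_iff]
  let σ : X ⟶ power X Ω := Limits.Pi.lift fun j =>
    if j = w then 𝟙 X else CategoryStruct.comp (Over.homMk X.hom) (p j)
  refine (KPoints.continuous_map σ).congr fun x => Pattern.toKPoint_eq _ _ fun j => ?_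
  have h1 : (x.map σ).map (Limits.Pi.π (fun _ : Ω => X) j) =
      x.map (if j = w then 𝟙 X else CategoryStruct.comp (Over.homMk X.hom) (p j)) :=
    (x.map_comp σ _).symm.trans (congrArg x.map (Limits.Pi.lift_π _ _))
  rw [h1]
  by_cases hj : j = w
  · subst hj
    rw [if_pos rfl, KPoints.map_id]
    exact (Function.update_self (β := fun _ : Ω => KPoints X) j x p).symm
  · rw [if_neg hj, KPoints.map_const]
    exact (Function.update_of_ne (β := fun _ : Ω => KPoints X) hj x p).symm

/-- Nullstellensatz: `X` is Jacobson, so a nonempty open set contains a closed point, which is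
`K`-rational because `K` is algebraically closed. -/
theorem KPoints.exists_toPoint_mem [IsAlgClosed K] [LocallyOfFiniteType X.hom]
    (U : Set X.left) (hU : IsOpen U) (hne : U.Nonempty) : ∃ x : KPoints X, x.toPoint ∈ U := by
  have : JacobsonSpace X.left := LocallyOfFiniteType.jacobsonSpace X.hom
  obtain ⟨x, hxU, hx⟩ := nonempty_inter_closedPoints hne hU.isLocallyClosed
  refine ⟨Over.homMk (pointOfClosedPoint X.hom x hx) (pointOfClosedPoint_comp _ _ _), ?_⟩
  have h : (pointOfClosedPoint X.hom x hx) (IsLocalRing.closedPoint K : PrimeSpectrum K) = x :=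
    pointOfClosedPoint_apply X.hom x hx _
  exact Set.mem_of_eq_of_mem h hxU

theorem KPoints.preirreducibleSpace [IsAlgClosed K] [LocallyOfFiniteType X.hom]
    [PreirreducibleSpace X.left] : PreirreducibleSpace (KPoints X) := by
  refine ⟨?_⟩
  rintro _ _ ⟨U, hU, rfl⟩ ⟨V, hV, rfl⟩ ⟨x, -, hx⟩ ⟨y, -, hy⟩
  obtain ⟨z, -, hz⟩ := PreirreducibleSpace.isPreirreducible_univ (X := X.left) _ _ hU hV
    ⟨_, trivial, hx⟩ ⟨_, trivial, hy⟩
  obtain ⟨w, hw⟩ := KPoints.exists_toPoint_mem (U ∩ V) (hU.inter hV) ⟨z, hz⟩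
  exact ⟨w, trivial, hw⟩

theorem Pattern.preirreducibleSpace [IsAlgClosed K] [LocallyOfFiniteType X.hom]
    [PreirreducibleSpace X.left] (Ω : Finset G) : PreirreducibleSpace (Pattern X Ω) := by
  classical
  have : PreirreducibleSpace (KPoints X) := KPoints.preirreducibleSpace
  exact preirreducibleSpace_pi (ι := Ω) (A := KPoints X) (instTopologicalSpacePattern X Ω)
    fun p w => Pattern.continuous_update p w

end Points

/-! ### Affine charts and their products -/

section Charts

variable (X) in
/-- An affine chart of a `K`-scheme, with coordinate ring a finitely generated `K`-algebra. -/
structure Chart where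
  /-- the coordinate ring -/
  R : Type u
  [commRing : CommRing R]
  [algebra : Algebra K R]
  /-- the open immersion -/
  ι : Spec (CommRingCat.of R) ⟶ X.left
  [isOpenImmersion : IsOpenImmersion ι]
  comp_hom : ι ≫ X.hom = Spec.map (CommRingCat.ofHom (algebraMap K R))
  finiteType : Algebra.FiniteType K R

attribute [instance] Chart.commRing Chart.algebra Chart.isOpenImmersion

namespace Chart

theorem exists_mem_range [LocallyOfFiniteType X.hom] (x : X.left) :
    ∃ c : Chart X, x ∈ Set.range c.ι := by
  obtain ⟨R, f, hf, y, hy⟩ := X.left.exists_Spec_apply_eq x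
  let φ := Spec.preimage (f ≫ X.hom)
  have hφ : Spec.map φ = f ≫ X.hom := Spec.map_preimage _
  let : Algebra K R := φ.hom.toAlgebra
  have hft : RingHom.FiniteType φ.hom := by
    have : LocallyOfFiniteType (Spec.map φ) := by rw [hφ]; infer_instance
    exact HasRingHomProperty.Spec_iff.mp this
  exact ⟨{ R := R, ι := f, isOpenImmersion := hf, comp_hom := hφ.symm, finiteType := hft }, y, hy⟩

theorem ringKrullDim_le (c : Chart X) : ringKrullDim c.R ≤ topologicalKrullDim X.left := by
  rw [← PrimeSpectrum.topologicalKrullDim_eq_ringKrullDim]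
  exact c.ι.isOpenEmbedding.isInducing.topologicalKrullDim_le

theorem exists_ringKrullDim_le (c : Chart X) : ∃ n : ℕ, ringKrullDim c.R ≤ n := by
  have := c.finiteType
  obtain ⟨n, f, hf⟩ := Algebra.FiniteType.iff_quotient_mvPolynomial''.mp this
  refine ⟨n, (ringKrullDim_le_of_surjective f.toRingHom hf).trans ?_⟩
  simp

/-- The `K`-point given by a `K`-algebra morphism from the coordinate ring of a chart. -/
def pt (c : Chart X) (φ : c.R →ₐ[K] K) : KPoints X :=
  Over.homMk (Spec.map (CommRingCat.ofHom φ.toRingHom) ≫ c.ι) (by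
    simp [c.comp_hom, ← Spec.map_comp, ← CommRingCat.ofHom_comp])

/-- `Spec K` is a single point, so a `K`-point factors through an open immersion as soon as its
image point lies in the range. -/
theorem mem_range_pt (c : Chart X) (x : KPoints X) :
    x ∈ Set.range c.pt ↔ x.toPoint ∈ Set.range c.ι := by
  constructor
  · rintro ⟨φ, rfl⟩
    exact ⟨_, rfl⟩
  · intro hx
    have hsub : Set.range (CommaMorphism.left x) ⊆ Set.range c.ι := by
      rintro _ ⟨y, rfl⟩
      have : y = (IsLocalRing.closedPoint K : PrimeSpectrum K) :=
        Subsingleton.elim (α := PrimeSpectrum K) _ _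
      exact this ▸ hx
    let y := IsOpenImmersion.lift c.ι (CommaMorphism.left x) hsub
    have hy : y ≫ c.ι = CommaMorphism.left x := IsOpenImmersion.lift_fac _ _ _
    let ψ := Spec.preimage y
    have hψ : Spec.map ψ = y := Spec.map_preimage _
    have hψ' : CommRingCat.ofHom (algebraMap K c.R) ≫ ψ = 𝟙 _ := by
      apply Spec.map_injective
      rw [Spec.map_comp, hψ, ← c.comp_hom, ← Category.assoc, hy, Spec.map_id]
      exact Over.w x
    refine ⟨⟨ψ.hom, fun r => congrArg (fun f => f.hom r) hψ'⟩, ?_⟩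
    exact Over.OverMorphism.ext ((congrArg (· ≫ c.ι) hψ).trans hy)

/-- The points of a product of charts, in terms of coordinate rings. -/
abbrev Pts {ι : Type*} (c : ι → Chart X) : Type _ := ∀ i, (c i).R →ₐ[K] K

/-- The coordinate functions on the points of a product of charts. -/
def coord {ι : Type*} (c : ι → Chart X) (s : Σ i, (c i).R) (φ : Pts c) : K := φ s.1 s.2

/-- The pattern given by a point of a product of charts. -/
def pattern {Ω : Finset G} (c : Ω → Chart X) (φ : Pts c) : Pattern X Ω := fun w => (c w).pt (φ w)

theorem isOpen_range_pattern {Ω : Finset G} (c : Ω → Chart X) : IsOpen (Set.range (pattern c)) := by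
  have : Set.range (pattern c) = ⋂ w, {p : Pattern X Ω | p w ∈ Set.range (c w).pt} := by
    ext p
    simp only [Set.mem_range, Set.mem_iInter, Set.mem_ofPred_eq]
    constructor
    · rintro ⟨φ, rfl⟩ w
      exact ⟨_, rfl⟩
    · intro h
      choose φ hφ using h
      exact ⟨φ, funext hφ⟩
  rw [this]
  refine isOpen_iInter_of_finite fun w => ?_
  have h2 : Set.range (c w).pt = KPoints.toPoint ⁻¹' (Set.range (c w).ι) :=
    Set.ext fun x => mem_range_pt _ _
  exact (h2 ▸ (c w).ι.isOpenEmbedding.isOpen_range.preimage continuous_induced_dom :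
    IsOpen (Set.range (c w).pt)).preimage (Pattern.continuous_eval w)

end Chart

end Charts

end

end AlgMeanDim

namespace AlgMeanDim

noncomputable section

universe u v

variable {K : Type u} [Field K] {X : Over (Spec (CommRingCat.of K))} {G : Type v}

/-! ### The Zariski topology of a product of charts through coordinate functions -/

section EvalPt

variable {Z : Scheme.{u}}

/-- The value of a global section at a morphism from the spectrum of a field. -/
def evalPt (x : Spec (CommRingCat.of K) ⟶ Z) : Γ(Z, ⊤) →+* K :=
  (x.appTop ≫ (Scheme.ΓSpecIso (CommRingCat.of K)).hom).hom

theorem evalPt_appTop {R : CommRingCat.{u}} (x : Spec (CommRingCat.of K) ⟶ Z) (q : Z ⟶ Spec R)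
    (ψ : R ⟶ CommRingCat.of K) (h : x ≫ q = Spec.map ψ) (r : R) :
    evalPt x (q.appTop ((Scheme.ΓSpecIso R).inv r)) = ψ r := by
  have h1 : (Scheme.ΓSpecIso R).inv ≫ q.appTop ≫ x.appTop ≫ (Scheme.ΓSpecIso (.of K)).hom = ψ := by
    have : q.appTop ≫ x.appTop = (Spec.map ψ).appTop := by rw [← Scheme.Hom.comp_appTop, h]
    rw [reassoc_of% this, Scheme.ΓSpecIso_naturality, Iso.inv_hom_id_assoc]
  exact congrArg (fun f => f.hom r) h1

theorem mem_basicOpen_iff_evalPt (x : Spec (CommRingCat.of K) ⟶ Z) (s : Γ(Z, ⊤)) :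
    x (IsLocalRing.closedPoint K : PrimeSpectrum K) ∈ Z.basicOpen s ↔ evalPt x s ≠ 0 := by
  have h1 : x ⁻¹ᵁ Z.basicOpen s = _ := Scheme.preimage_basicOpen_top x s
  have h2 := basicOpen_eq_of_affine' (x.appTop s)
  change _ ∈ x ⁻¹ᵁ Z.basicOpen s ↔ _
  rw [h1, h2]
  have h3 : (IsLocalRing.closedPoint K).asIdeal = ⊥ :=
    IsLocalRing.isField_iff_maximalIdeal_eq.mp (Field.toIsField K)
  change _ ∉ (IsLocalRing.closedPoint K).asIdeal ↔ _
  rw [h3, Ideal.mem_bot]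
  rfl

end EvalPt

namespace Chart

instance {Ω : Finset G} (c : Ω → Chart X) : TopologicalSpace (Pts c) :=
  TopologicalSpace.induced (pattern c) inferInstance

theorem isInducing_pattern {Ω : Finset G} (c : Ω → Chart X) :
    Topology.IsInducing (pattern c) := ⟨rfl⟩

/-- On the open subscheme `V` of `X ^ Ω` where every coordinate lies in its chart, `f` is given by
evaluating a global section `s`; its non-vanishing locus is the trace of the basic open set of `s`.
-/
theorem isOpen_ne_zero {Ω : Finset G} (c : Ω → Chart X) (f : Pts c → K) (hf : f ∈ funAlg (coord c)) :
    IsOpen {φ | f φ ≠ 0} := by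
  let π (w : Ω) : power X Ω ⟶ X := Limits.Pi.π (fun _ : Ω => X) w
  let V : (power X Ω).left.Opens := ⨅ w, (π w).left ⁻¹ᵁ (c w).ι.opensRange
  have hV (w : Ω) : V ≤ (π w).left ⁻¹ᵁ (c w).ι.opensRange := iInf_le _ w
  let q (w : Ω) : V.toScheme ⟶ Spec (CommRingCat.of (c w).R) :=
    IsOpenImmersion.lift (c w).ι (V.ι ≫ (π w).left) (by
      rintro _ ⟨y, rfl⟩
      exact hV w y.2)
  have hq (w : Ω) : q w ≫ (c w).ι = V.ι ≫ (π w).left := IsOpenImmersion.lift_fac _ _ _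
  let z (φ : Pts c) : Spec (CommRingCat.of K) ⟶ (power X Ω).left :=
    CommaMorphism.left (pattern c φ).toKPoint
  have hzπ (φ : Pts c) (w : Ω) : z φ ≫ (π w).left =
      Spec.map (CommRingCat.ofHom (φ w).toRingHom) ≫ (c w).ι :=
    congrArg (fun y : KPoints X => CommaMorphism.left y) ((pattern c φ).map_π w)
  have hz (φ : Pts c) : Set.range (z φ) ⊆ Set.range V.ι := by
    rintro _ ⟨y, rfl⟩
    rw [Scheme.Opens.range_ι]
    have hmem : ∀ w, z φ y ∈ ((π w).left ⁻¹ᵁ (c w).ι.opensRange) := fun w => by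
      change (π w).left (z φ y) ∈ (c w).ι.opensRange
      rw [← Scheme.Hom.comp_apply, hzπ]
      exact ⟨_, rfl⟩
    exact (show z φ y ∈ V from by
      rw [← SetLike.mem_coe, TopologicalSpace.Opens.coe_iInf]
      exact Set.mem_iInter.mpr hmem)
  let x (φ : Pts c) : Spec (CommRingCat.of K) ⟶ V.toScheme := IsOpenImmersion.lift V.ι (z φ) (hz φ)
  have hx (φ : Pts c) : x φ ≫ V.ι = z φ := IsOpenImmersion.lift_fac _ _ _
  have hxq (φ : Pts c) (w : Ω) : x φ ≫ q w = Spec.map (CommRingCat.ofHom (φ w).toRingHom) := by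
    rw [← cancel_mono (c w).ι, Category.assoc, hq, ← Category.assoc, hx, hzπ]
  have hxK (φ : Pts c) : x φ ≫ V.ι ≫ (power X Ω).hom = Spec.map (𝟙 (CommRingCat.of K)) := by
    rw [← Category.assoc, hx, Spec.map_id]
    exact Over.w (pattern c φ).toKPoint
  obtain ⟨s, hs⟩ : ∃ s : Γ(V.toScheme, ⊤), ∀ φ, evalPt (x φ) s = f φ := by
    induction hf using Algebra.adjoin_induction with
    | mem f hf =>
      obtain ⟨⟨w, r⟩, rfl⟩ := hf
      exact ⟨(q w).appTop ((Scheme.ΓSpecIso _).inv r), fun φ => evalPt_appTop _ _ _ (hxq φ w) r⟩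
    | algebraMap k =>
      exact ⟨(V.ι ≫ (power X Ω).hom).appTop ((Scheme.ΓSpecIso _).inv k),
        fun φ => evalPt_appTop _ _ _ (hxK φ) k⟩
    | add f g _ _ hf hg =>
      obtain ⟨s, hs⟩ := hf
      obtain ⟨t, ht⟩ := hg
      exact ⟨s + t, fun φ => by rw [map_add, hs, ht]; rfl⟩
    | mul f g _ _ hf hg =>
      obtain ⟨s, hs⟩ := hf
      obtain ⟨t, ht⟩ := hg
      exact ⟨s * t, fun φ => by rw [map_mul, hs, ht]; rfl⟩
  have key : {φ | f φ ≠ 0} = (fun φ => (pattern c φ).toKPoint.toPoint) ⁻¹'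
      (V.ι ''ᵁ V.toScheme.basicOpen s : (power X Ω).left.Opens) := by
    ext φ
    rw [Set.mem_ofPred, ← hs, ← mem_basicOpen_iff_evalPt]
    have : (pattern c φ).toKPoint.toPoint = V.ι (x φ (IsLocalRing.closedPoint K : PrimeSpectrum K)) :=
      (congrArg (fun y : Spec (CommRingCat.of K) ⟶ (power X Ω).left =>
        y (IsLocalRing.closedPoint K : PrimeSpectrum K)) (hx φ)).symm
    rw [Set.mem_preimage, this]
    exact (Scheme.Hom.apply_mem_image_iff V.ι).symm
  rw [key]
  exact (TopologicalSpace.Opens.isOpen _).preimage (continuous_induced_dom.comp continuous_induced_dom)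

/-- The coordinates define a morphism from the spectrum of the function algebra to `X ^ Ω`. An open
set pulls back along it to a union of basic open sets, each cut out by a function. -/
theorem exists_ne_zero {Ω : Finset G} (c : Ω → Chart X) (φ : Pts c) (W : Set (Pts c))
    (hW : IsOpen W) (hφ : φ ∈ W) :
    ∃ f ∈ funAlg (coord c), f φ ≠ 0 ∧ ∀ ψ, f ψ ≠ 0 → ψ ∈ W := by
  obtain ⟨_, ⟨W, hW, rfl⟩, rfl⟩ := hW
  -- `G` may live in another universe than `K`; reindexing by `Fin` keeps `B` in the universe of
  -- `K`, so that its spectrum is a scheme over `Spec K`.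
  let e : Fin Ω.card ≃ Ω := Ω.equivFin.symm
  let c' : Fin Ω.card → Chart X := c ∘ e
  let ρ (φ : Pts c) : Pts c' := fun i => φ (e i)
  let B := funAlg (coord c')
  have hρ (f) (hf : f ∈ B) : f ∘ ρ ∈ funAlg (coord c) := by
    have h1 : f ∘ ρ ∈ funAlg fun s => coord c' s ∘ ρ := by
      rw [← map_precomp_funAlg]
      exact ⟨f, hf, rfl⟩
    refine Algebra.adjoin_mono ?_ h1
    rintro _ ⟨⟨i, r⟩, rfl⟩
    exact ⟨⟨e i, r⟩, rfl⟩
  let SB : Over (Spec (CommRingCat.of K)) :=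
    Over.mk (Spec.map (CommRingCat.ofHom (algebraMap K B)))
  let ev (ψ : Pts c') : B →ₐ[K] K := (Pi.evalAlgHom K (fun _ : Pts c' => K) ψ).comp B.val
  let y (ψ : Pts c) : KPoints SB := Over.homMk (Spec.map (CommRingCat.ofHom (ev (ρ ψ)).toRingHom)) (by
    simp [SB, ← Spec.map_comp, ← CommRingCat.ofHom_comp])
  have hg (w : Ω) : ∃ g : SB ⟶ X, ∀ ψ, (y ψ).map g = pattern c ψ w := by
    obtain ⟨i, rfl⟩ := e.surjective w
    let a : (c (e i)).R →ₐ[K] B :=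
      { toFun := fun r => ⟨fun ψ => ψ i r, Algebra.subset_adjoin ⟨⟨i, r⟩, rfl⟩⟩
        map_one' := Subtype.ext (funext fun ψ => map_one (ψ i))
        map_mul' := fun r s => Subtype.ext (funext fun ψ => map_mul (ψ i) r s)
        map_zero' := Subtype.ext (funext fun ψ => map_zero (ψ i))
        map_add' := fun r s => Subtype.ext (funext fun ψ => map_add (ψ i) r s)
        commutes' := fun k => Subtype.ext (funext fun ψ => (ψ i).commutes k) }
    refine ⟨Over.homMk (Spec.map (CommRingCat.ofHom a.toRingHom) ≫ (c (e i)).ι) (by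
      simp [SB, (c (e i)).comp_hom, ← Spec.map_comp, ← CommRingCat.ofHom_comp]), fun ψ => ?_⟩
    refine Over.OverMorphism.ext ?_
    change Spec.map _ ≫ Spec.map _ ≫ _ = Spec.map _ ≫ _
    rw [← Category.assoc, ← Spec.map_comp, ← CommRingCat.ofHom_comp]
    rfl
  choose g hg using hg
  let h : SB ⟶ power X Ω := Limits.Pi.lift g
  have hy (ψ : Pts c) : (y ψ).map h = (pattern c ψ).toKPoint := by
    refine Pattern.toKPoint_eq _ _ fun w => ?_
    rw [← hg]
    exact ((y ψ).map_comp h _).symm.trans (congrArg (y ψ).map (Limits.Pi.lift_π _ _))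
  have hyp (ψ : Pts c) : (y ψ).toPoint = evalPrime B (ρ ψ) := by
    refine PrimeSpectrum.ext (Ideal.ext fun b => ?_)
    rw [mem_evalPrime]
    have h3 : (IsLocalRing.closedPoint K).asIdeal = ⊥ :=
      IsLocalRing.isField_iff_maximalIdeal_eq.mp (Field.toIsField K)
    change ev (ρ ψ) b ∈ (IsLocalRing.closedPoint K).asIdeal ↔ _
    rw [h3, Ideal.mem_bot]
    rfl
  have hmem (ψ : Pts c) : ψ ∈ pattern c ⁻¹' ((fun p => p.toKPoint.toPoint) ⁻¹' W) ↔
      evalPrime B (ρ ψ) ∈ (h.left ⁻¹' W : Set (PrimeSpectrum B)) := by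
    rw [← hyp]
    change (pattern c ψ).toKPoint.toPoint ∈ W ↔ h.left (y ψ).toPoint ∈ W
    rw [← hy]
    rfl
  obtain ⟨_, ⟨b, rfl⟩, hb1, hb2⟩ :=
    PrimeSpectrum.isTopologicalBasis_basic_opens.exists_subset_of_mem_open ((hmem φ).mp hφ)
      (hW.preimage h.left.continuous)
  exact ⟨_, hρ b b.2, hb1, fun ψ hψ => (hmem ψ).mpr (hb2 hψ)⟩

theorem isZariski {Ω : Finset G} (c : Ω → Chart X) : IsZariski (funAlg (coord c)) :=
  ⟨isOpen_ne_zero c, exists_ne_zero c⟩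

end Chart

end

end AlgMeanDim

namespace AlgMeanDim

noncomputable section

universe u v

variable {K : Type u} [Field K] {X : Over (Spec (CommRingCat.of K))} {G : Type v}

namespace Chart

/-! ### Coordinate algebras of families of points and the dimension count -/

section CoordAlg

variable {ι Y : Type*} (c : ι → Chart X) (g : Y → Pts c)

/-- The algebra of functions generated by the coordinates of a family of points. -/
def coordAlg : Subalgebra K (Y → K) := funAlg fun s => coord c s ∘ g

/-- The functions of one coordinate of a family of points. -/
def coordHom (i : ι) : (c i).R →ₐ[K] (Y → K) where
  toFun r y := g y i r
  map_one' := funext fun y => map_one (g y i)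
  map_mul' r s := funext fun y => map_mul (g y i) r s
  map_zero' := funext fun y => map_zero (g y i)
  map_add' r s := funext fun y => map_add (g y i) r s
  commutes' k := funext fun y => (g y i).commutes k

theorem coordAlg_eq_iSup : coordAlg c g = ⨆ i, (coordHom c g i).range := by
  apply le_antisymm
  · refine Algebra.adjoin_le ?_
    rintro _ ⟨⟨i, r⟩, rfl⟩
    exact le_iSup (fun i => (coordHom c g i).range) i ⟨r, rfl⟩
  · refine iSup_le fun i => ?_
    rintro _ ⟨r, rfl⟩
    exact Algebra.subset_adjoin ⟨⟨i, r⟩, rfl⟩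

theorem fg_range_coordHom (i : ι) : (coordHom c g i).range.FG := by
  have := (c i).finiteType
  rw [← Algebra.map_top]
  exact this.out.map _

theorem ringKrullDim_range_coordHom_le (i : ι) :
    ringKrullDim (coordHom c g i).range ≤ ringKrullDim (c i).R :=
  ringKrullDim_le_of_surjective (coordHom c g i).rangeRestrict.toRingHom
    (coordHom c g i).rangeRestrict_surjective

theorem fg_coordAlg [Finite ι] : (coordAlg c g).FG := by
  rw [coordAlg_eq_iSup]
  exact fg_iSup _ (fg_range_coordHom c g)

theorem ringKrullDim_coordAlg_le [Fintype ι] {d : ℕ} (hd : ∀ c : Chart X, ringKrullDim c.R ≤ d) :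
    ringKrullDim (coordAlg c g) ≤ (Fintype.card ι * d : ℕ) := by
  rw [coordAlg_eq_iSup]
  refine (ringKrullDim_iSup_le_sum _ (fg_range_coordHom c g) (fun _ => d) fun i =>
    (ringKrullDim_range_coordHom_le c g i).trans (hd _)).trans ?_
  simp

end CoordAlg

theorem preirreducibleSpace_pts {Ω : Finset G} (c : Ω → Chart X)
    [PreirreducibleSpace (Pattern X Ω)] : PreirreducibleSpace (Pts c) := by
  refine ⟨?_⟩
  rintro _ _ ⟨U, hU, rfl⟩ ⟨V, hV, rfl⟩ ⟨x, -, hx⟩ ⟨y, -, hy⟩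
  obtain ⟨_, -, ⟨hz, z, rfl⟩, hz', -⟩ :=
    PreirreducibleSpace.isPreirreducible_univ (X := Pattern X Ω) _ _
      (hU.inter (isOpen_range_pattern c)) (hV.inter (isOpen_range_pattern c))
      ⟨_, trivial, hx, _, rfl⟩ ⟨_, trivial, hy, _, rfl⟩
  exact ⟨z, trivial, hz, hz'⟩

/-- Inside a product of charts, a proper closed subset has dimension less than the expected one. -/
theorem ringKrullDim_coordAlg_succ_le {Ω : Finset G} [PreirreducibleSpace (Pattern X Ω)]
    {d : ℕ} (hd : ∀ c : Chart X, ringKrullDim c.R ≤ d) (c : Ω → Chart X)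
    {C : Set (Pattern X Ω)} (hC : IsClosed C) (hC' : C ≠ Set.univ) {Y : Type*} [Nonempty Y]
    (g : Y → Pts c) (hg : ∀ y, pattern c (g y) ∈ C) :
    ringKrullDim (coordAlg c g) + 1 ≤ (Ω.card * d : ℕ) := by
  have : PreirreducibleSpace (Pts c) := preirreducibleSpace_pts c
  have : Nonempty (Pts c) := ‹Nonempty Y›.map g
  obtain ⟨p, hp⟩ := Set.nonempty_compl.mpr hC'
  -- The chart product is nonempty and open, so by irreducibility it has a point outside `C`; the
  -- function `f` is chosen nonzero there and zero on `C`.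
  obtain ⟨_, -, hφ, φ, rfl⟩ := PreirreducibleSpace.isPreirreducible_univ (X := Pattern X Ω) _ _
    hC.isOpen_compl (isOpen_range_pattern c) ⟨p, trivial, hp⟩
    ⟨_, trivial, Set.mem_range_self (Classical.arbitrary (Pts c))⟩
  have : IsDomain (funAlg (coord c)) := (isZariski c).isDomain
  obtain ⟨f, hf, hfφ, hfC⟩ := exists_ne_zero c φ (pattern c ⁻¹' Cᶜ)
    (hC.isOpen_compl.preimage (isInducing_pattern c).continuous) hφ
  refine (ringKrullDim_funAlg_comp_succ_le (coord c) g f hf (fun h => hfφ (congrFun h φ)) ?_).trans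
    ((ringKrullDim_coordAlg_le c id hd).trans (by simp))
  funext y
  by_contra hy
  exact hfC (g y) hy (hg y)

/-- Since `Y` is nonempty the algebra is nontrivial of dimension at least `0`, which forces `1 ≤
Ω.card * d`; the natural subtraction is therefore not truncated. -/
theorem ringKrullDim_coordAlg_le_pred {Ω : Finset G} [PreirreducibleSpace (Pattern X Ω)]
    {d : ℕ} (hd : ∀ c : Chart X, ringKrullDim c.R ≤ d) (c : Ω → Chart X)
    {C : Set (Pattern X Ω)} (hC : IsClosed C) (hC' : C ≠ Set.univ) {Y : Type*} [Nonempty Y]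
    (g : Y → Pts c) (hg : ∀ y, pattern c (g y) ∈ C) :
    1 ≤ Ω.card * d ∧ ringKrullDim (coordAlg c g) ≤ (Ω.card * d - 1 : ℕ) := by
  have h1 := ringKrullDim_coordAlg_succ_le hd c hC hC' g hg
  have h2 : 0 ≤ ringKrullDim (coordAlg c g) := ringKrullDim_nonneg_of_nontrivial
  generalize ringKrullDim (coordAlg c g) = r at h1 h2
  generalize Ω.card * d = N at h1
  have h3 : 1 ≤ N := by
    have : (1 : WithBot ℕ∞) ≤ N := (le_add_of_nonneg_left h2).trans h1
    exact_mod_cast this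
  obtain ⟨N, rfl⟩ := Nat.exists_eq_add_of_le' h3
  refine ⟨h3, ?_⟩
  induction r with
  | bot => exact bot_le
  | coe r =>
    have h4 : r + 1 ≤ (N : ℕ∞) + 1 := by exact_mod_cast h1
    have h5 : r ≤ N := (ENat.add_le_add_iff_right ENat.one_ne_top).mp h4
    rw [Nat.add_sub_cancel]
    exact_mod_cast h5

/-- The dimension of a set of patterns is computed in charts. -/
theorem topologicalKrullDim_le [LocallyOfFiniteType X.hom] {Ω : Finset G} (S : Set (Pattern X Ω))
    {n : WithBot ℕ∞} (h : ∀ c : Ω → Chart X,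
      ringKrullDim (coordAlg c (Subtype.val : pattern c ⁻¹' S → Pts c)) ≤ n) :
    topologicalKrullDim S ≤ n := by
  refine topologicalKrullDim_le_of_openCover (κ := Ω → Chart X)
    (fun c => Subtype.val ⁻¹' Set.range (pattern c))
    (fun c => (isOpen_range_pattern c).preimage continuous_subtype_val) (fun p => ?_) fun c => ?_
  · choose c hc using fun w => exists_mem_range (p.1 w).toPoint
    choose φ hφ using fun w => (mem_range_pt (c w) (p.1 w)).mpr (hc w)
    exact ⟨c, φ, funext hφ⟩
  · have hsec : ∀ p : (Subtype.val ⁻¹' Set.range (pattern c) : Set S),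
        ∃ φ : pattern c ⁻¹' S, pattern c φ = p.1.1 := by
      rintro ⟨⟨p, hp⟩, φ, hφ⟩
      exact ⟨⟨φ, Set.mem_preimage.mpr (hφ ▸ hp)⟩, hφ⟩
    choose s hs using hsec
    -- Composing the section `s` with the inducing map `pattern c` gives back the inclusion, so `s`
    -- is inducing.
    have hind : Topology.IsInducing s := by
      have h1 : Topology.IsInducing fun φ : pattern c ⁻¹' S => pattern c φ :=
        (isInducing_pattern c).comp .subtypeVal
      rw [← h1.of_comp_iff]
      convert (Topology.IsInducing.subtypeVal (t := S)).comp
        (Topology.IsInducing.subtypeVal (t := Subtype.val ⁻¹' Set.range (pattern c)))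
      exact funext hs
    refine hind.topologicalKrullDim_le.trans (le_trans ?_ (h c))
    exact ((isZariski c).comp_inducing .subtypeVal).topologicalKrullDim_le

end Chart

open Chart

/-- The dimension bound for the restriction of `Γ` to a set containing disjoint finite sets on
which `Γ` is not everything. -/
theorem topologicalKrullDim_proj_le [LocallyOfFiniteType X.hom]
    (hirr : ∀ Ω : Finset G, PreirreducibleSpace (Pattern X Ω))
    {d : ℕ} (hd : ∀ c : Chart X, ringKrullDim c.R ≤ d) {Γ : Set (G → KPoints X)} (hΓ : Γ.Nonempty)
    {τ : Type*} (t : Finset τ) (B : τ → Finset G) (hdisj : (t : Set τ).PairwiseDisjoint B)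
    (hB : ∀ i ∈ t, IsClosed (proj Γ (B i)) ∧ proj Γ (B i) ≠ Set.univ)
    (Ω : Finset G) (hBΩ : ∀ i ∈ t, B i ⊆ Ω) :
    ∃ n : ℕ, topologicalKrullDim (proj Γ Ω) ≤ n ∧ n + t.card = Ω.card * d := by
  classical
  -- A single element of `Γ`, seen as a one-point family, suffices; this is where `Γ` must be
  -- nonempty.
  have hone : ∀ i ∈ t, 1 ≤ (B i).card * d := by
    intro i hi
    obtain ⟨γ, hγ⟩ := hΓ
    choose c hc using fun w : B i => exists_mem_range (γ w).toPoint
    choose φ hφ using fun w => (mem_range_pt (c w) (γ w)).mpr (hc w)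
    have := hirr (B i)
    exact (ringKrullDim_coordAlg_le_pred hd c (hB i hi).1 (hB i hi).2 (fun _ : Unit => φ)
      fun _ => ⟨γ, hγ, (funext hφ).symm⟩).1
  have hcard : ∑ i ∈ t, ((B i).card * d - 1) + t.card = (t.biUnion B).card * d := by
    rw [Finset.card_biUnion fun i hi j hj h => hdisj hi hj h, Finset.sum_mul, Finset.card_eq_sum_ones,
      ← Finset.sum_add_distrib]
    exact Finset.sum_congr rfl fun i hi => Nat.sub_add_cancel (hone i hi)
  have hsub : t.biUnion B ⊆ Ω := Finset.biUnion_subset.mpr hBΩ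
  refine ⟨∑ i ∈ t, ((B i).card * d - 1) + (Ω \ t.biUnion B).card * d,
    Chart.topologicalKrullDim_le _ fun c => ?_, ?_⟩
  swap
  · rw [← Finset.card_sdiff_add_card_eq_card hsub, add_mul, ← hcard]
    ring
  set Y := pattern c ⁻¹' proj Γ Ω
  rcases isEmpty_or_nonempty Y with hY | hY
  · rw [ringKrullDim_eq_bot_of_subsingleton]
    exact bot_le
  let incl (i : t) (w : B i) : Ω := ⟨w, hBΩ i i.2 w.2⟩
  let restr (i : t) (y : Y) : Pts (c ∘ incl i) := fun w => y.1 (incl i w)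
  -- One block of functions for each tile, of dimension at most `|B i| * d - 1`, and one for each
  -- coordinate outside the tiles, of dimension at most `d`.
  let S : t ⊕ {w : Ω // w.1 ∉ t.biUnion B} → Subalgebra K (Y → K) :=
    Sum.elim (fun i => coordAlg (c ∘ incl i) (restr i)) fun w => (coordHom c Subtype.val w.1).range
  let n : t ⊕ {w : Ω // w.1 ∉ t.biUnion B} → ℕ :=
    Sum.elim (fun i => (B i).card * d - 1) fun _ => d
  have hS : coordAlg c (Subtype.val : Y → Pts c) = ⨆ i, S i := by
    apply le_antisymm
    · rw [coordAlg_eq_iSup]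
      refine iSup_le fun w => ?_
      by_cases hw : w.1 ∈ t.biUnion B
      · obtain ⟨i, hi, hwi⟩ := Finset.mem_biUnion.mp hw
        refine le_trans ?_ (le_iSup S (Sum.inl ⟨i, hi⟩))
        rintro _ ⟨r, rfl⟩
        exact Algebra.subset_adjoin ⟨⟨⟨w, hwi⟩, r⟩, rfl⟩
      · exact le_iSup S (Sum.inr ⟨w, hw⟩)
    · refine iSup_le ?_
      rintro (i | w)
      · refine Algebra.adjoin_mono ?_
        rintro _ ⟨⟨w, r⟩, rfl⟩
        exact ⟨⟨incl i w, r⟩, rfl⟩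
      · rw [coordAlg_eq_iSup]
        exact le_iSup (fun w => (coordHom c (Subtype.val : Y → Pts c) w).range) w.1
  rw [hS]
  have hfg : ∀ i, (S i).FG := by
    rintro (i | w)
    · exact fg_coordAlg _ _
    · exact fg_range_coordHom _ _ _
  have hdim : ∀ i, ringKrullDim (S i) ≤ n i := by
    rintro (i | w)
    · have := hirr (B i)
      refine (ringKrullDim_coordAlg_le_pred hd (c ∘ incl i) (hB i i.2).1 (hB i i.2).2 (restr i)
        fun y => ?_).2
      obtain ⟨γ, hγ, h⟩ := y.2
      exact ⟨γ, hγ, funext fun w => congrFun h (incl i w)⟩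
    · exact (ringKrullDim_range_coordHom_le _ _ _).trans (hd _)
  refine (ringKrullDim_iSup_le_sum S hfg n hdim).trans (le_of_eq ?_)
  have h1 : Fintype.card {w : Ω // w.1 ∉ t.biUnion B} = (Ω \ t.biUnion B).card := by
    rw [← Fintype.card_coe]
    exact Fintype.card_congr ((Equiv.subtypeSubtypeEquivSubtypeInter (· ∈ Ω) (· ∉ t.biUnion B)).trans
      (Equiv.subtypeEquivRight fun w => Finset.mem_sdiff.symm))
  simp only [n, Fintype.sum_sum_type, Sum.elim_inl, Sum.elim_inr, Finset.sum_const, Finset.card_univ,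
    h1, smul_eq_mul]
  rw [Finset.sum_coe_sort t fun i => (B i).card * d - 1]

end

end AlgMeanDim

namespace AlgMeanDim

noncomputable section

universe u v w

/-! ### Density of tiles along a Følner net -/

section Group

open scoped Classical in
/-- Along a Følner net, the tiles contained in `F i` have positive density. -/
theorem IsFolnerNet.exists_density {G : Type v} [Group G] {I : Type w} [Preorder I]
    {F : I → Finset G} (hF : IsFolnerNet F) {E E' : Finset G} {T : Set G} (hT : IsTiling E E' T) :
    ∃ ε : ℝ, 0 < ε ∧ ∀ᶠ i in Filter.atTop, ∃ t : Finset G,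
      (∀ g ∈ t, g ∈ T ∧ translate g E ⊆ F i) ∧ ε * (F i).card ≤ t.card := by
  have hE' : 0 < E'.card := by
    obtain ⟨g, -, hg⟩ := hT.cover 1
    exact Finset.card_pos.mpr (Finset.image_nonempty.mp ⟨_, hg⟩)
  have hsum : Filter.Tendsto (fun i => ∑ p ∈ E ×ˢ E',
      (((F i) \ (F i).image (fun h => h * (p.1⁻¹ * p.2))).card : ℝ) / ((F i).card : ℝ))
      Filter.atTop (nhds 0) := by
    simpa using tendsto_finsetSum (E ×ˢ E') fun p _ => hF.tendsto (p.1⁻¹ * p.2)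
  -- At least half of the points of `F i` are good, and at most `|E'|` of them select the same tile.
  refine ⟨1 / (2 * E'.card), by positivity, ?_⟩
  filter_upwards [hsum.eventually_lt_const (show (0 : ℝ) < 1 / 2 by norm_num)] with i hi
  have hFi : (0 : ℝ) < (F i).card := by exact_mod_cast Finset.card_pos.mpr (hF.nonempty i)
  choose τ hτT hτ using hT.cover
  -- If `x = g * e'` then `g * e = x * (e'⁻¹ * e)`, so the tile selected by a good point lies in `F
  -- i`.
  let good := (F i).filter fun x => ∀ e ∈ E, ∀ e' ∈ E', x * (e'⁻¹ * e) ∈ F i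
  refine ⟨good.image τ, ?_, ?_⟩
  · intro g hg
    obtain ⟨x, hx, rfl⟩ := Finset.mem_image.mp hg
    refine ⟨hτT x, fun y hy => ?_⟩
    obtain ⟨e, he, rfl⟩ := Finset.mem_image.mp hy
    obtain ⟨e', he', hx'⟩ := Finset.mem_image.mp (hτ x)
    have h := (Finset.mem_filter.mp hx).2 e he e' he'
    have h2 : τ x * e = x * (e'⁻¹ * e) := by
      conv_rhs => rw [← hx']
      group
    exact h2 ▸ h
  · have h1 : good.card ≤ E'.card * (good.image τ).card := by
      refine Finset.card_le_mul_card_image good _ fun g _ => ?_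
      refine (Finset.card_le_card fun x hx => ?_).trans
        (Finset.card_image_le (s := E') (f := fun h => g * h))
      rw [← (Finset.mem_filter.mp hx).2]
      exact hτ x
    have h2 : (F i \ good) ⊆ (E ×ˢ E').biUnion
        fun p => (F i) \ (F i).image (fun h => h * (p.1⁻¹ * p.2)) := by
      intro x hx
      obtain ⟨hxF, hx⟩ := Finset.mem_sdiff.mp hx
      have hx' : ¬ ∀ e ∈ E, ∀ e' ∈ E', x * (e'⁻¹ * e) ∈ F i := fun h =>
        hx (Finset.mem_filter.mpr ⟨hxF, h⟩)
      push Not at hx'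
      obtain ⟨e, he, e', he', h⟩ := hx'
      refine Finset.mem_biUnion.mpr ⟨(e, e'), Finset.mk_mem_product he he',
        Finset.mem_sdiff.mpr ⟨hxF, fun hmem => ?_⟩⟩
      obtain ⟨y, hy, rfl⟩ := Finset.mem_image.mp hmem
      apply h
      convert hy
      group
    have h3 : ((F i \ good).card : ℝ) ≤ ∑ p ∈ E ×ˢ E',
        (((F i) \ (F i).image (fun h => h * (p.1⁻¹ * p.2))).card : ℝ) := by
      exact_mod_cast (Finset.card_le_card h2).trans Finset.card_biUnion_le
    rw [← Finset.sum_div, div_lt_iff₀ hFi] at hi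
    have h4 : ((F i \ good).card : ℝ) + good.card = (F i).card := by
      exact_mod_cast Finset.card_sdiff_add_card_eq_card (Finset.filter_subset _ _)
    have h5 : (good.card : ℝ) ≤ E'.card * (good.image τ).card := by exact_mod_cast h1
    have hE'R : (0 : ℝ) < E'.card := by exact_mod_cast hE'
    rw [div_mul_eq_mul_div, div_le_iff₀ (by positivity)]
    linarith

end Group

/-! ### Finiteness of the dimension and the final estimate -/

section Dimension

theorem dimToEReal_mono {a b : WithBot ℕ∞} (h : a ≤ b) : dimToEReal a ≤ dimToEReal b := by
  induction a with
  | bot => exact bot_le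
  | coe a =>
    induction b with
    | bot => simp at h
    | coe b =>
      have h1 : a ≤ b := by exact_mod_cast h
      exact EReal.coe_ennreal_le_coe_ennreal_iff.mpr (ENat.toENNReal_le.mpr h1)

theorem dimToEReal_natCast (n : ℕ) : dimToEReal (n : WithBot ℕ∞) = ((n : ℝ) : EReal) := by
  change (((n : ℕ∞) : ENNReal) : EReal) = _
  have h : ((n : ℕ∞) : ENNReal) = ((n : NNReal) : ENNReal) := by simp
  rw [h]
  rfl

variable {K : Type u} [Field K] {X : Over (Spec (CommRingCat.of K))}

/-- The dimension of a non-empty algebraic variety is a natural number. -/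
theorem IsAlgebraicVariety.exists_topologicalKrullDim_eq (hX : IsAlgebraicVariety X)
    [Nonempty X.left] : ∃ d : ℕ, topologicalKrullDim X.left = d := by
  have := hX.locallyOfFiniteType
  have := hX.quasiCompact
  have hcomp : CompactSpace X.left := QuasiCompact.compactSpace_of_compactSpace X.hom
  choose c hc using fun x : X.left => Chart.exists_mem_range x
  obtain ⟨s, hs⟩ := isCompact_univ.elim_finite_subcover (fun x => Set.range (c x).ι)
    (fun x => (c x).ι.isOpenEmbedding.isOpen_range) fun x _ => Set.mem_iUnion.mpr ⟨x, hc x⟩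
  choose n hn using fun x => (c x).exists_ringKrullDim_le
  have hle : topologicalKrullDim X.left ≤ (s.sup n : ℕ) := by
    refine topologicalKrullDim_le_of_openCover (κ := s) (fun x => Set.range (c x).ι)
      (fun x => (c x).ι.isOpenEmbedding.isOpen_range) (fun y => ?_) fun x => ?_
    · obtain ⟨x, hx, hy⟩ := Set.mem_iUnion₂.mp (hs (Set.mem_univ y))
      exact ⟨⟨x, hx⟩, hy⟩
    · refine ((c x).ι.isOpenEmbedding.isEmbedding.toHomeomorph.symm.isInducing.topologicalKrullDim_le).trans ?_
      have h1 : topologicalKrullDim (PrimeSpectrum (c x).R) ≤ _ :=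
        (PrimeSpectrum.topologicalKrullDim_eq_ringKrullDim (c x).R).trans_le (hn x)
      refine h1.trans ?_
      exact_mod_cast Finset.le_sup (f := n) x.2
  have h0 : 0 ≤ topologicalKrullDim X.left := by
    have : Nonempty (TopologicalSpace.IrreducibleCloseds X.left) :=
      ⟨⟨closure {Classical.arbitrary X.left}, isIrreducible_singleton.closure, isClosed_closure⟩⟩
    exact Order.krullDim_nonneg
  generalize topologicalKrullDim X.left = r at hle h0
  induction r with
  | bot => simp at h0
  | coe r =>
    have h1 : r ≤ (s.sup n : ℕ) := by exact_mod_cast hle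
    obtain ⟨d, hd⟩ := ENat.ne_top_iff_exists.mp (ne_top_of_le_ne_top (ENat.natCast_ne_top _) h1)
    exact ⟨d, by rw [← hd]; rfl⟩

end Dimension

end

end AlgMeanDim

open AlgMeanDim in
theorem mainTheorem11 {G : Type*} [Group G]
    {I : Type*} [Preorder I] [IsDirected I (· ≤ ·)] [Nonempty I]
    (F : I → Finset G) (hF : AlgMeanDim.IsFolnerNet F)
    {K : Type*} [Field K] [IsAlgClosed K]
    (X : Over (Spec (CommRingCat.of K))) (hX : AlgMeanDim.IsAlgebraicVariety X)
    (hirr : IrreducibleSpace X.left)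
    (Γ : Set (G → AlgMeanDim.KPoints X))
    (hΓ : ∃ (E E' : Finset G) (T : Set G), AlgMeanDim.IsTiling E E' T ∧
      ∀ g ∈ T,
        IsClosed (AlgMeanDim.proj Γ (AlgMeanDim.translate g E)) ∧
        AlgMeanDim.proj Γ (AlgMeanDim.translate g E) ≠ Set.univ) :
    AlgMeanDim.mdim F Γ < AlgMeanDim.kdim X.left := by
  obtain ⟨E, E', T, hT, hproj⟩ := hΓ
  have := hX.locallyOfFiniteType
  obtain ⟨d, hd⟩ := hX.exists_topologicalKrullDim_eq
  obtain ⟨ε, hε, hev⟩ := hF.exists_density hT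
  -- Strictness uses that `d` is finite. As `ε` does not depend on `i`, it survives the upper limit.
  have hlt : ((d - ε : ℝ) : EReal) < kdim X.left := by
    rw [kdim, hd, dimToEReal_natCast]
    exact_mod_cast sub_lt_self _ hε
  refine lt_of_le_of_lt ?_ hlt
  refine Filter.limsup_le_of_le (by isBoundedDefault) ?_
  filter_upwards [hev] with i hi
  obtain ⟨t, ht, hcard⟩ := hi
  have hFi : (0 : ℝ) < (F i).card := by exact_mod_cast Finset.card_pos.mpr (hF.nonempty i)
  -- For empty `Γ` the tile count fails when `d = 0`, but the dimension is `⊥`, and so is its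
  -- quotient by `|F i|`.
  rcases Γ.eq_empty_or_nonempty with rfl | hne
  · have h1 : kdim (proj (∅ : Set (G → KPoints X)) (F i)) = ⊥ := by
      have : IsEmpty (proj (∅ : Set (G → KPoints X)) (F i)) :=
        Set.isEmpty_coe_sort.mpr (Set.image_empty _)
      have h2 : IsEmpty (TopologicalSpace.IrreducibleCloseds (proj (∅ : Set (G → KPoints X)) (F i))) :=
        ⟨fun Z => this.elim Z.2.nonempty.some⟩
      rw [kdim, topologicalKrullDim, Order.krullDim_eq_bot]
      rfl
    rw [h1, EReal.bot_div_of_pos_ne_top (by exact_mod_cast hFi) (EReal.coe_ne_top _)]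
    exact bot_le
  · obtain ⟨n, hn, hnt⟩ := topologicalKrullDim_proj_le
      (fun Ω : Finset G => Pattern.preirreducibleSpace (X := X) Ω)
      (fun c => c.ringKrullDim_le.trans hd.le) hne t (translate · E)
      (fun g hg h hh hgh => hT.disjoint g (ht g hg).1 h (ht h hh).1 hgh)
      (fun g hg => hproj g (ht g hg).1) (F i) fun g hg => (ht g hg).2
    have h1 : kdim (proj Γ (F i)) ≤ ((n : ℝ) : EReal) := by
      rw [← dimToEReal_natCast]
      exact dimToEReal_mono hn
    refine (EReal.div_le_div_right_of_nonneg (by exact_mod_cast hFi.le) h1).trans ?_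
    rw [← EReal.coe_div, EReal.coe_le_coe_iff, div_le_iff₀ hFi]
    have h2 : (n : ℝ) + t.card = (F i).card * d := by exact_mod_cast hnt
    linarith
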